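/- Let $N,k,q$ be integers with $N\ge 1$ and $1\le q\le k$, let $M_{x_1},\dots,M_{x_N}\in\mathbb R^{k\times k}$ be symmetric positive semidefinite matrices (the information matrices of the design points $x_1,\dots,x_N$), let $g:\mathbb R^k\to\mathbb R^q$ be differentiable at $\theta\in\mathbb R^k$ with Jacobian $G=\partial g(\theta)/\partial\theta^T\in\mathbb R^{q\times k}$, and let $0\le p<\infty$ and $0<\varepsilon<1$. Put $$\Omega_\varepsilon=\Big\{w\in\mathbb R^N:\ 0\le w_i\le\varepsilon\ (1\le i\le N),\ \sum_{i=1}^N w_i=1\Big\},\qquad M(w)=\sum_{i=1}^N w_iM_{x_i},\qquad \Sigma_g(w)=G\,M(w)^{-1}G^T .$$ For a symmetric positive semidefinite $\Sigma\in\mathbb R^{q\times q}$ let $\Phi_p(\Sigma)=\big(q^{-1}\operatorname{Tr}\Sigma^p\big)^{1/p}$ if $p>0$ and $\Phi_0(\Sigma)=|\Sigma|^{1/q}$. For $w$ with $M(w)$ positive definite let $$\phi_p(x_i,w)=\kappa_p(w)\,\operatorname{Tr}\!\Big(\Sigma_g(w)^{p-1}\,G\,M(w)^{-1}M_{x_i}M(w)^{-1}G^T\Big),$$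 where $\kappa_p(w)=q^{-1/p}\big(\operatorname{Tr}\Sigma_g(w)^p\big)^{1/p-1}$ if $p>0$ and $\kappa_0(w)=q^{-1}|\Sigma_g(w)|^{1/q}$ (the limit as $p\to0$). Powers of matrices are taken by spectral calculus; if $G$ does not have rank $q$, so that $\Sigma_g(w)$ is singular, the conventions $0^0=1$ and $0^s=0$ for $s\neq 0$ are used, for eigenvalues and for scalars. Suppose that $w$ solves $$\min_{w\in\Omega_\varepsilon}\Phi_p(\Sigma_g(w)),$$ where the objective counts as $+\infty$ when $M(w)$ is singular and a solution is required to have a finite value; that is, $w\in\Omega_\varepsilon$, $M(w)$ is positive definite, and $\Phi_p(\Sigma_g(w))\le\Phi_p(\Sigma_g(w'))$ for all $w'\in\Omega_\varepsilon$ with $M(w')$ positive definite. Then there exists a constant $c\in\mathbb R$ such that for every $1\le i\le N$: (i) $w_i=0$ if $\phi_p(x_i,w)<c$; (ii) $w_i=\varepsilon$ if $\phi_p(x_i,w)>c$; (iii) $0\le w_i\le\varepsilon$ if $\phi_p(x_i,w)=c$. -/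

import Mathlib

noncomputable section

namespace PhiOpt

/-- The `q × k` Jacobian matrix `∂g(θ)/∂θᵀ`; its `(a, b)` entry is the partial derivative of the
`a`-th component of `g` with respect to the `b`-th coordinate, at `θ`. -/
def jacobian {k q : ℕ} (g : EuclideanSpace ℝ (Fin k) → EuclideanSpace ℝ (Fin q))
    (θ : EuclideanSpace ℝ (Fin k)) : Matrix (Fin q) (Fin k) ℝ :=
  Matrix.of fun a b => (fderiv ℝ g θ (EuclideanSpace.single b 1)) a

/-- The real power `A ^ s` of a symmetric positive semidefinite matrix, by the spectral
(functional) calculus: same eigenvectors, each eigenvalue `t` replaced by `t ^ s`.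
For singular `A` and `s < 0` this is the power of the Moore–Penrose inverse. -/
def matPow {q : ℕ} (A : Matrix (Fin q) (Fin q) ℝ) (s : ℝ) : Matrix (Fin q) (Fin q) ℝ :=
  cfc (fun t : ℝ => t ^ s) A

/-- `Ω_ε`: the probability weight vectors all of whose entries are at most `ε`. -/
def Omega (N : ℕ) (ε : ℝ) : Set (Fin N → ℝ) :=
  {w | (∀ i, 0 ≤ w i ∧ w i ≤ ε) ∧ ∑ i, w i = 1}

/-- The information matrix `M(w) = ∑ i, w i • M_{x_i}`. -/
def infoMatrix {N k : ℕ} (Mx : Fin N → Matrix (Fin k) (Fin k) ℝ) (w : Fin N → ℝ) :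
    Matrix (Fin k) (Fin k) ℝ :=
  ∑ i, w i • Mx i

/-- `Σ_g(w) = G M(w)⁻¹ Gᵀ`, where `G` is the Jacobian of `g`. -/
def Sigma {N k q : ℕ} (G : Matrix (Fin q) (Fin k) ℝ) (Mx : Fin N → Matrix (Fin k) (Fin k) ℝ)
    (w : Fin N → ℝ) : Matrix (Fin q) (Fin q) ℝ :=
  G * (infoMatrix Mx w)⁻¹ * G.transpose

/-- Kiefer's criterion `Φ_p(S) = (q⁻¹ Tr S^p)^{1/p}` for `p > 0`, and its limit
`Φ_0(S) = |S|^{1/q}` for `p = 0`. -/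
def Phi {q : ℕ} (p : ℝ) (S : Matrix (Fin q) (Fin q) ℝ) : ℝ :=
  if p = 0 then S.det ^ (1 / (q : ℝ))
  else ((q : ℝ)⁻¹ * (matPow S p).trace) ^ (1 / p)

/-- The generalized leverage `φ_p(x_i, w)`: for `p > 0` it is
`q^{-1/p} (Tr S^p)^{1/p-1} Tr(S^{p-1} G M(w)⁻¹ M_{x_i} M(w)⁻¹ Gᵀ)` with `S = Σ_g(w)`,
and for `p = 0` the limit of this expression as `p → 0`, where the scalar factor becomes
`q⁻¹ |S|^{1/q}`. -/
def leverage {N k q : ℕ} (p : ℝ) (G : Matrix (Fin q) (Fin k) ℝ)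
    (Mx : Fin N → Matrix (Fin k) (Fin k) ℝ) (i : Fin N) (w : Fin N → ℝ) : ℝ :=
  (if p = 0 then (q : ℝ)⁻¹ * (Sigma G Mx w).det ^ (1 / (q : ℝ))
    else (q : ℝ) ^ (-1 / p) * (matPow (Sigma G Mx w) p).trace ^ (1 / p - 1)) *
  (matPow (Sigma G Mx w) (p - 1) * G * (infoMatrix Mx w)⁻¹ * Mx i *
    (infoMatrix Mx w)⁻¹ * G.transpose).trace

/-- `w` solves `min_{w ∈ Ω_ε} Φ_p(Σ_g(w))`. Since `Σ_g(w)` involves `M(w)⁻¹`, the objective is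
defined only where `M(w)` is positive definite and counts as `+∞` elsewhere: a solution is a
weight vector in `Ω_ε` with `M(w) > 0` whose value is least among all such vectors. -/
def IsSolution {N k q : ℕ} (p ε : ℝ) (G : Matrix (Fin q) (Fin k) ℝ)
    (Mx : Fin N → Matrix (Fin k) (Fin k) ℝ) (w : Fin N → ℝ) : Prop :=
  w ∈ Omega N ε ∧ (infoMatrix Mx w).PosDef ∧
    ∀ w' ∈ Omega N ε, (infoMatrix Mx w').PosDef →
      Phi p (Sigma G Mx w) ≤ Phi p (Sigma G Mx w')

end PhiOpt

end

/-! ### Trace inequalities for functions of symmetric matrices. -/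

section

open Matrix

/-! Exchange argument: if `w i > 0` and `w j < ε`, moving a small mass `t` from `i` to `j` stays
feasible, so by optimality the criterion cannot drop. A first-order upper bound on its change with
quadratic error (`exists_variation_nonneg`), divided by `t → 0`, gives `φ j ≤ φ i`
(`leverage_le_of_exchange`). Hence some `c` separates the leverages (`exists_threshold`). The matrix
power is never differentiated: the bound is a scalar inequality summed over pairs of eigenvalues.
This also covers singular `Σ_g`, whose kernel is `ker Gᵀ` for every admissible `w`. -/

theorem Matrix.IsHermitian.trace_cfc_mul_cfc {n : Type*} [Fintype n] [DecidableEq n]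
    {A B : Matrix n n ℝ} (hA : A.IsHermitian) (hB : B.IsHermitian) (f g : ℝ → ℝ) :
    (cfc f B * cfc g A).trace = ∑ i, ∑ j,
      ((star (hB.eigenvectorUnitary : Matrix n n ℝ) * (hA.eigenvectorUnitary : Matrix n n ℝ)) i j)
        ^ 2 * (f (hB.eigenvalues i) * g (hA.eigenvalues j)) := by
  set U : Matrix n n ℝ := ↑hB.eigenvectorUnitary with hU
  set V : Matrix n n ℝ := ↑hA.eigenvectorUnitary with hV
  have h1 : cfc f B = U * diagonal (f ∘ hB.eigenvalues) * star U := by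
    rw [hB.cfc_eq, IsHermitian.cfc, Unitary.conjStarAlgAut_apply]; rfl
  have h2 : cfc g A = V * diagonal (g ∘ hA.eigenvalues) * star V := by
    rw [hA.cfc_eq, IsHermitian.cfc, Unitary.conjStarAlgAut_apply]; rfl
  have h3 : cfc f B * cfc g A = U * (diagonal (f ∘ hB.eigenvalues) * (star U * V) *
      (diagonal (g ∘ hA.eigenvalues) * star V)) := by
    rw [h1, h2]; simp only [mul_assoc]
  have h4 : diagonal (f ∘ hB.eigenvalues) * (star U * V) *
      (diagonal (g ∘ hA.eigenvalues) * star V) * U =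
      diagonal (f ∘ hB.eigenvalues) * (star U * V) *
        (diagonal (g ∘ hA.eigenvalues) * star (star U * V)) := by
    rw [star_mul, star_star]; simp only [mul_assoc]
  rw [h3, trace_mul_comm, h4]
  simp only [trace, diag_apply]
  refine Finset.sum_congr rfl fun i _ => ?_
  rw [mul_apply]
  refine Finset.sum_congr rfl fun j _ => ?_
  rw [diagonal_mul, diagonal_mul, star_apply, star_trivial ((star U * V) i j)]
  simp only [Function.comp]
  ring

theorem Matrix.continuousOn_real_spectrum {n : Type*} [Fintype n] [DecidableEq n]
    (A : Matrix n n ℝ) (f : ℝ → ℝ) : ContinuousOn f (spectrum ℝ A) :=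
  (Matrix.finite_real_spectrum (A := A)).continuousOn f

/-- Null eigenvectors of `A` lie in `ker B`, hence are orthogonal to the eigenvectors of `B` with
nonzero eigenvalue. -/
theorem Matrix.IsHermitian.eigenvector_overlap_eq_zero {n : Type*} [Fintype n] [DecidableEq n]
    {A B : Matrix n n ℝ} (hA : A.IsHermitian) (hB : B.IsHermitian)
    (hker : ∀ v, A *ᵥ v = 0 → B *ᵥ v = 0) {i j : n}
    (hj : hA.eigenvalues j = 0) (hi : hB.eigenvalues i ≠ 0) :
    (star (hB.eigenvectorUnitary : Matrix n n ℝ) *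
      (hA.eigenvectorUnitary : Matrix n n ℝ)) i j = 0 := by
  set U : Matrix n n ℝ := ↑hB.eigenvectorUnitary with hU
  set V : Matrix n n ℝ := ↑hA.eigenvectorUnitary with hV
  have hUU : star U * U = 1 := Unitary.coe_star_mul_self hB.eigenvectorUnitary
  have hBs : B = U * diagonal hB.eigenvalues * star U := by
    conv_lhs => rw [hB.spectral_theorem, Unitary.conjStarAlgAut_apply]
    rfl
  have h0 : B *ᵥ (fun l => V l j) = 0 := by
    apply hker
    have h := hA.mulVec_eigenvectorBasis j
    rw [hj, zero_smul] at h
    convert h using 2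
    exact hA.eigenvectorUnitary_col_eq j
  have h1 : star U * B = diagonal hB.eigenvalues * star U := by
    conv_lhs => rw [hBs]
    simp only [← mul_assoc, hUU, one_mul]
  have h2 : (star U * (B * V)) i j = hB.eigenvalues i * (star U * V) i j := by
    rw [← mul_assoc, h1, mul_assoc, diagonal_mul]
  have h3 : (star U * (B * V)) i j = 0 := by
    rw [mul_apply]
    refine Finset.sum_eq_zero fun l _ => ?_
    have : (B * V) l j = (B *ᵥ (fun l => V l j)) l := rfl
    rw [this, h0, Pi.zero_apply, mul_zero]
  rw [h3] at h2
  exact (mul_eq_zero.mp h2.symm).resolve_left hi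

/-- A Klein-type inequality: in the two eigenbases every trace is a double sum with the same
weights, the squared overlaps, so the scalar bound is applied termwise. Pairs exempt from `hfg` have
weight zero. -/
theorem Matrix.IsHermitian.trace_cfc_le_of_quadratic_bound {n : Type*} [Fintype n] [DecidableEq n]
    {A B : Matrix n n ℝ} (hA : A.IsHermitian) (hB : B.IsHermitian)
    (hker : ∀ v, A *ᵥ v = 0 → B *ᵥ v = 0) {f g : ℝ → ℝ} {C : ℝ}
    (hfg : ∀ i j, (hA.eigenvalues j = 0 → hB.eigenvalues i = 0) →
      f (hB.eigenvalues i) ≤ f (hA.eigenvalues j) +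
        g (hA.eigenvalues j) * (hB.eigenvalues i - hA.eigenvalues j) +
        C * (hB.eigenvalues i - hA.eigenvalues j) ^ 2) :
    (cfc f B).trace ≤ (cfc f A).trace + (cfc g A * (B - A)).trace +
      C * ((B - A) * (B - A)).trace := by
  have hA' : IsSelfAdjoint A := hA
  have hB' : IsSelfAdjoint B := hB
  have hc : ∀ (X : Matrix n n ℝ) (h : ℝ → ℝ), ContinuousOn h (spectrum ℝ X) :=
    Matrix.continuousOn_real_spectrum
  have e1 := hA.trace_cfc_mul_cfc hB f fun _ => 1
  rw [cfc_const_one ℝ A, mul_one] at e1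
  have e2 := hA.trace_cfc_mul_cfc hB (fun _ => 1) f
  rw [cfc_const_one ℝ B, one_mul] at e2
  have e3 := hA.trace_cfc_mul_cfc hB (fun x => x) g
  rw [cfc_id' ℝ B, trace_mul_comm] at e3
  have e4 := hA.trace_cfc_mul_cfc hB (fun _ => 1) fun x => g x * x
  rw [cfc_const_one ℝ B, one_mul, cfc_mul g (fun x => x) A (hc _ _) (hc _ _), cfc_id' ℝ A] at e4
  have e5 := hA.trace_cfc_mul_cfc hB (fun x => x * x) fun _ => 1
  rw [cfc_const_one ℝ A, mul_one, cfc_mul (fun x => x) (fun x => x) B (hc _ _) (hc _ _),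
    cfc_id' ℝ B] at e5
  have e6 := hA.trace_cfc_mul_cfc hB (fun _ => 1) fun x => x * x
  rw [cfc_const_one ℝ B, one_mul, cfc_mul (fun x => x) (fun x => x) A (hc _ _) (hc _ _),
    cfc_id' ℝ A] at e6
  have e7 := hA.trace_cfc_mul_cfc hB (fun x => x) fun x => x
  rw [cfc_id' ℝ A, cfc_id' ℝ B] at e7
  have e8 : ((B - A) * (B - A)).trace = (B * B).trace - 2 * (B * A).trace + (A * A).trace := by
    simp only [sub_mul, mul_sub, trace_sub, trace_mul_comm A B]; ring
  rw [e8, mul_sub, trace_sub, e1, e2, e3, e4, e5, e6, e7, ← sub_nonneg]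
  simp only [Finset.mul_sum, ← Finset.sum_sub_distrib, ← Finset.sum_add_distrib]
  refine Finset.sum_nonneg fun i _ => Finset.sum_nonneg fun j _ => ?_
  by_cases h : hA.eigenvalues j = 0 → hB.eigenvalues i = 0
  · have := mul_nonneg (sq_nonneg ((star (hB.eigenvectorUnitary : Matrix n n ℝ) *
      (hA.eigenvectorUnitary : Matrix n n ℝ)) i j)) (sub_nonneg.2 (hfg i j h))
    refine this.trans_eq ?_
    ring
  · push Not at h
    rw [hA.eigenvector_overlap_eq_zero hB hker h.1 h.2]
    simp

theorem Matrix.IsHermitian.trace_cfc {n : Type*} [Fintype n] [DecidableEq n]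
    {A : Matrix n n ℝ} (hA : A.IsHermitian) (f : ℝ → ℝ) :
    (cfc f A).trace = ∑ i, f (hA.eigenvalues i) := by
  rw [hA.cfc_eq, IsHermitian.cfc, Unitary.conjStarAlgAut_apply, trace_mul_comm, ← mul_assoc,
    Unitary.coe_star_mul_self, one_mul, trace_diagonal]
  rfl

theorem Matrix.PosSemidef.eigenvalues_le_trace {n : Type*} [Fintype n] [DecidableEq n]
    {A : Matrix n n ℝ} (hA : A.PosSemidef) (i : n) : hA.1.eigenvalues i ≤ A.trace := by
  rw [hA.1.trace_eq_sum_eigenvalues]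
  exact Finset.single_le_sum (f := fun i => hA.1.eigenvalues i)
    (fun j _ => hA.eigenvalues_nonneg j) (Finset.mem_univ i)

theorem Matrix.PosDef.trace_cfc_log {n : Type*} [Fintype n] [DecidableEq n]
    {A : Matrix n n ℝ} (hA : A.PosDef) : (cfc Real.log A).trace = Real.log A.det := by
  rw [hA.1.trace_cfc, hA.1.det_eq_prod_eigenvalues]
  exact (Real.log_prod fun i _ => (hA.eigenvalues_pos i).ne').symm

/-! ### Scalar quadratic bounds. -/

theorem Real.exists_rpow_le_quadratic {p : ℝ} (hp : 0 ≤ p) (R : ℝ) :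
    ∃ C : ℝ, 0 ≤ C ∧ ∀ x, 0 ≤ x → x ≤ R → x ^ p ≤ 1 + p * (x - 1) + C * (x - 1) ^ 2 := by
  obtain ⟨n, hn⟩ := exists_nat_ge p
  induction n generalizing p with
  | zero =>
    have : p = 0 := le_antisymm (by simpa using hn) hp
    exact ⟨0, le_rfl, fun x _ _ => by simp [this]⟩
  | succ n ih =>
    by_cases h1 : p ≤ 1
    · refine ⟨0, le_rfl, fun x hx _ => ?_⟩
      have := rpow_one_add_le_one_add_mul_self (s := x - 1) (by linarith) hp h1
      rw [add_sub_cancel] at this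
      linarith
    · push Not at h1
      obtain ⟨C, hC, h⟩ := ih (p := p - 1) (by linarith) (by push_cast at hn; linarith)
      -- With `y = x - 1`, `(1 + y) * (1 + (p - 1) * y) = 1 + p * y + (p - 1) * y ^ 2`; the old
      -- error gains a factor `x ≤ max R 0`.
      refine ⟨(p - 1) + C * max R 0, by positivity, fun x hx hxR => ?_⟩
      have hx' : x ^ p = x * x ^ (p - 1) := by
        conv_lhs => rw [← add_sub_cancel 1 p, Real.rpow_add' hx (by linarith), Real.rpow_one]
      have h2 := mul_le_mul_of_nonneg_left (h x hx hxR) hx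
      have h3 : C * (x - 1) ^ 2 * x ≤ C * (x - 1) ^ 2 * max R 0 :=
        mul_le_mul_of_nonneg_left (hxR.trans (le_max_left _ _)) (by positivity)
      rw [hx']
      nlinarith

theorem Real.exists_rpow_div_le_quadratic {p a : ℝ} (hp : 0 < p) (ha : 0 < a) (R : ℝ) :
    ∃ C : ℝ, 0 ≤ C ∧ ∀ b, 0 ≤ b → b ≤ R →
      b ^ p / p ≤ a ^ p / p + a ^ (p - 1) * (b - a) + C * (b - a) ^ 2 := by
  obtain ⟨C, hC, h⟩ := Real.exists_rpow_le_quadratic hp.le (R / a)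
  refine ⟨a ^ p / p * C / a ^ 2, by positivity, fun b hb hbR => ?_⟩
  have h1 := h (b / a) (by positivity) (by gcongr)
  have hap : 0 < a ^ p / p := by positivity
  have h2 := mul_le_mul_of_nonneg_left h1 hap.le
  have h3 : a ^ p / p * (b / a) ^ p = b ^ p / p := by
    rw [Real.div_rpow hb ha.le]
    have := (Real.rpow_pos_of_pos ha p).ne'
    field_simp
  rw [h3] at h2
  refine h2.trans_eq ?_
  rw [Real.rpow_sub_one ha.ne']
  field_simp

theorem Real.log_le_log_add_inv_mul_sub {a b : ℝ} (ha : 0 < a) (hb : 0 < b) :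
    Real.log b ≤ Real.log a + a⁻¹ * (b - a) := by
  have h := Real.log_le_sub_one_of_pos (div_pos hb ha)
  rw [Real.log_div hb.ne' ha.ne'] at h
  have : a⁻¹ * (b - a) = b / a - 1 := by field_simp
  linarith

namespace PhiOpt

open Filter Topology

/-! ### First-order variation of the criterion. -/

theorem exists_trace_matPow_le {q : ℕ} {p : ℝ} (hp : 0 < p) {A : Matrix (Fin q) (Fin q) ℝ}
    (hA : A.PosSemidef) (R : ℝ) :
    ∃ C : ℝ, ∀ B : Matrix (Fin q) (Fin q) ℝ, B.PosSemidef → (∀ v, A *ᵥ v = 0 → B *ᵥ v = 0) →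
      B.trace ≤ R → (matPow B p).trace / p ≤ (matPow A p).trace / p +
        (matPow A (p - 1) * (B - A)).trace + C * ((B - A) * (B - A)).trace := by
  have hex : ∀ j, ∃ C : ℝ, 0 ≤ C ∧ (hA.1.eigenvalues j ≠ 0 → ∀ b, 0 ≤ b → b ≤ R →
      b ^ p / p ≤ hA.1.eigenvalues j ^ p / p +
        hA.1.eigenvalues j ^ (p - 1) * (b - hA.1.eigenvalues j) +
        C * (b - hA.1.eigenvalues j) ^ 2) := by
    intro j
    by_cases h0 : hA.1.eigenvalues j = 0
    · exact ⟨0, le_rfl, fun h => absurd h0 h⟩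
    · obtain ⟨C, hC, h⟩ := Real.exists_rpow_div_le_quadratic hp
        (lt_of_le_of_ne (hA.eigenvalues_nonneg j) (Ne.symm h0)) R
      exact ⟨C, hC, fun _ => h⟩
  choose C hC h using hex
  -- The sum dominates each `C j`, giving one constant for all eigenvalues.
  refine ⟨∑ j, C j, fun B hB hker hR => ?_⟩
  have key := hA.1.trace_cfc_le_of_quadratic_bound hB.1 hker (f := fun t => t ^ p / p)
    (g := fun t => t ^ (p - 1)) (C := ∑ j, C j) ?_
  · have e : ∀ X : Matrix (Fin q) (Fin q) ℝ, X.IsHermitian →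
        (cfc (fun t : ℝ => t ^ p / p) X).trace = (matPow X p).trace / p := by
      intro X hX
      rw [matPow, hX.trace_cfc, hX.trace_cfc, Finset.sum_div]
    rwa [e A hA.1, e B hB.1] at key
  · intro i j hij
    by_cases h0 : hA.1.eigenvalues j = 0
    · simp [h0, hij h0]
    · refine (h j h0 _ (hB.eigenvalues_nonneg i) ((hB.eigenvalues_le_trace i).trans hR)).trans ?_
      gcongr
      exact Finset.single_le_sum (fun j _ => hC j) (Finset.mem_univ j)

/-- Concavity of `log` removes the quadratic term. -/
theorem log_det_le {q : ℕ} {A B : Matrix (Fin q) (Fin q) ℝ} (hA : A.PosDef) (hB : B.PosDef) :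
    Real.log B.det ≤ Real.log A.det + (matPow A (-1) * (B - A)).trace := by
  have key := hA.1.trace_cfc_le_of_quadratic_bound hB.1 (f := Real.log)
    (g := fun t => t ^ (-1 : ℝ)) (C := 0) ?_ ?_
  · rw [hA.trace_cfc_log, hB.trace_cfc_log] at key
    simpa [matPow] using key
  · intro v hv
    have : v = 0 := by
      have h := congrArg (A⁻¹ *ᵥ ·) hv
      simpa [nonsing_inv_mul _ ((isUnit_iff_isUnit_det _).1 hA.isUnit)] using h
    simp [this]
  · intro i j _
    rw [Real.rpow_neg_one, zero_mul, add_zero]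
    exact Real.log_le_log_add_inv_mul_sub (hA.eigenvalues_pos j) (hB.eigenvalues_pos i)

theorem trace_matPow_nonneg {q : ℕ} {A : Matrix (Fin q) (Fin q) ℝ} (hA : A.PosSemidef) (s : ℝ) :
    0 ≤ (matPow A s).trace := by
  rw [matPow, hA.1.trace_cfc]
  exact Finset.sum_nonneg fun i _ => Real.rpow_nonneg (hA.eigenvalues_nonneg i) s

theorem trace_matPow_le_of_Phi_le {q : ℕ} (hq : 1 ≤ q) {p : ℝ} (hp : 0 < p)
    {A B : Matrix (Fin q) (Fin q) ℝ} (hA : A.PosSemidef) (hB : B.PosSemidef)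
    (h : Phi p A ≤ Phi p B) : (matPow A p).trace ≤ (matPow B p).trace := by
  have hq' : (0 : ℝ) < q := by exact_mod_cast hq
  have hA0 := trace_matPow_nonneg hA p
  have hB0 := trace_matPow_nonneg hB p
  rw [Phi, Phi, if_neg hp.ne', if_neg hp.ne',
    Real.rpow_le_rpow_iff (by positivity) (by positivity) (by positivity)] at h
  exact le_of_mul_le_mul_left h (by positivity)

theorem det_le_of_Phi_zero_le {q : ℕ} (hq : 1 ≤ q) {A B : Matrix (Fin q) (Fin q) ℝ}
    (hA : A.PosSemidef) (hB : B.PosSemidef) (h : Phi 0 A ≤ Phi 0 B) : A.det ≤ B.det := by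
  have hq' : (0 : ℝ) < q := by exact_mod_cast hq
  rwa [Phi, Phi, if_pos rfl, if_pos rfl,
    Real.rpow_le_rpow_iff hA.det_nonneg hB.det_nonneg (by positivity)] at h

theorem exists_variation_nonneg {q : ℕ} (hq : 1 ≤ q) {p : ℝ} (hp : 0 ≤ p)
    {A : Matrix (Fin q) (Fin q) ℝ} (hA : A.PosSemidef) (hdet : p = 0 → A.det ≠ 0) (R : ℝ) :
    ∃ C : ℝ, ∀ B : Matrix (Fin q) (Fin q) ℝ, B.PosSemidef → (∀ v, A *ᵥ v = 0 → B *ᵥ v = 0) →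
      B.trace ≤ R → Phi p A ≤ Phi p B →
      0 ≤ (matPow A (p - 1) * (B - A)).trace + C * ((B - A) * (B - A)).trace := by
  rcases hp.eq_or_lt with rfl | hp
  · refine ⟨0, fun B hB _ _ hPhi => ?_⟩
    have hle := det_le_of_Phi_zero_le hq hA hB hPhi
    have hApos : 0 < A.det := lt_of_le_of_ne hA.det_nonneg (hdet rfl).symm
    have hA' : A.PosDef := hA.posDef_iff_det_ne_zero.2 hApos.ne'
    have hB' : B.PosDef := hB.posDef_iff_det_ne_zero.2 (hApos.trans_le hle).ne'
    have := log_det_le hA' hB'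
    have := Real.log_le_log hApos hle
    rw [zero_sub, zero_mul, add_zero]
    linarith
  · obtain ⟨C, hC⟩ := exists_trace_matPow_le hp hA R
    refine ⟨C, fun B hB hker hR hPhi => ?_⟩
    have h1 := hC B hB hker hR
    have h2 := div_le_div_of_nonneg_right (trace_matPow_le_of_Phi_le hq hp hA hB hPhi) hp.le
    linarith

/-! ### Feasible exchanges and the perturbation of `Σ_g`. -/

theorem Sigma_posSemidef {N k q : ℕ} (G : Matrix (Fin q) (Fin k) ℝ)
    (Mx : Fin N → Matrix (Fin k) (Fin k) ℝ) {w : Fin N → ℝ} (hM : (infoMatrix Mx w).PosDef) :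
    (Sigma G Mx w).PosSemidef := by
  simpa [Sigma] using hM.inv.posSemidef.mul_mul_conjTranspose_same G

theorem Sigma_mulVec_eq_zero {N k q : ℕ} (G : Matrix (Fin q) (Fin k) ℝ)
    (Mx : Fin N → Matrix (Fin k) (Fin k) ℝ) {w : Fin N → ℝ} (hM : (infoMatrix Mx w).PosDef)
    (w' : Fin N → ℝ) {v : Fin q → ℝ} (hv : Sigma G Mx w *ᵥ v = 0) :
    Sigma G Mx w' *ᵥ v = 0 := by
  have h0 : Gᵀ *ᵥ v = 0 := by
    by_contra hne
    have h := hM.inv.dotProduct_mulVec_pos hne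
    have e : star (Gᵀ *ᵥ v) ⬝ᵥ ((infoMatrix Mx w)⁻¹ *ᵥ (Gᵀ *ᵥ v)) =
        v ⬝ᵥ (Sigma G Mx w *ᵥ v) := by
      rw [star_trivial, mulVec_transpose, ← dotProduct_mulVec, ← mulVec_transpose, mulVec_mulVec,
        mulVec_mulVec, Sigma, Matrix.mul_assoc]
    rw [e, hv, dotProduct_zero] at h
    exact lt_irrefl _ h
  rw [Sigma, ← mulVec_mulVec, h0, mulVec_zero]

theorem infoMatrix_add {N k : ℕ} (Mx : Fin N → Matrix (Fin k) (Fin k) ℝ) (u v : Fin N → ℝ) :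
    infoMatrix Mx (u + v) = infoMatrix Mx u + infoMatrix Mx v := by
  simp [infoMatrix, add_smul, Finset.sum_add_distrib]

theorem infoMatrix_smul {N k : ℕ} (Mx : Fin N → Matrix (Fin k) (Fin k) ℝ) (t : ℝ)
    (v : Fin N → ℝ) : infoMatrix Mx (t • v) = t • infoMatrix Mx v := by
  simp [infoMatrix, Finset.smul_sum, mul_smul]

theorem infoMatrix_single_sub_single {N k : ℕ} (Mx : Fin N → Matrix (Fin k) (Fin k) ℝ)
    (i j : Fin N) : infoMatrix Mx (Pi.single j 1 - Pi.single i 1) = Mx j - Mx i := by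
  simp [infoMatrix, sub_smul, Finset.sum_sub_distrib, Pi.single_apply, ite_smul]

theorem infoMatrix_posDef_of_half_le {N k : ℕ} {Mx : Fin N → Matrix (Fin k) (Fin k) ℝ}
    (hMx : ∀ i, (Mx i).PosSemidef) {w w' : Fin N → ℝ} (hM : (infoMatrix Mx w).PosDef)
    (h : ∀ i, w i / 2 ≤ w' i) : (infoMatrix Mx w').PosDef := by
  -- `M(w')` is half of `M(w)` plus a nonnegative combination of the `Mx i`.
  have e : w' = (1 / 2 : ℝ) • w + (w' - (1 / 2 : ℝ) • w) := by abel
  rw [e, infoMatrix_add, infoMatrix_smul]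
  refine (hM.smul (by norm_num)).add_posSemidef ?_
  refine Matrix.posSemidef_sum _ fun i _ => (hMx i).smul ?_
  have := h i
  simp only [Pi.sub_apply, Pi.smul_apply, smul_eq_mul]
  linarith

theorem eventually_exchange_mem {N k : ℕ} {Mx : Fin N → Matrix (Fin k) (Fin k) ℝ}
    (hMx : ∀ i, (Mx i).PosSemidef) {ε : ℝ} {w : Fin N → ℝ} (hw : w ∈ Omega N ε)
    (hM : (infoMatrix Mx w).PosDef) {i j : Fin N} (hij : i ≠ j) (hi : 0 < w i) (hj : w j < ε) :
    ∀ᶠ t : ℝ in 𝓝[>] 0, w + t • (Pi.single j 1 - Pi.single i 1) ∈ Omega N ε ∧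
      (infoMatrix Mx (w + t • (Pi.single j 1 - Pi.single i 1))).PosDef := by
  have h1 : ∀ᶠ t : ℝ in 𝓝[>] 0, t < min (w i / 2) (ε - w j) :=
    nhdsWithin_le_nhds (eventually_lt_nhds (lt_min (by linarith) (by linarith)))
  filter_upwards [h1, self_mem_nhdsWithin] with t ht ht0
  have ht0 : 0 < t := ht0
  have hti : t < w i / 2 := ht.trans_le (min_le_left _ _)
  have htj : t < ε - w j := ht.trans_le (min_le_right _ _)
  have hval : ∀ l, w l / 2 ≤ (w + t • (Pi.single j 1 - Pi.single i 1) : Fin N → ℝ) l ∧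
      (w + t • (Pi.single j 1 - Pi.single i 1) : Fin N → ℝ) l ≤ ε := by
    intro l
    have hl := hw.1 l
    by_cases hli : l = i
    · subst hli
      simp only [Pi.add_apply, Pi.smul_apply, Pi.sub_apply, Pi.single_eq_same,
        Pi.single_eq_of_ne hij, smul_eq_mul]
      constructor <;> linarith
    · by_cases hlj : l = j
      · subst hlj
        simp only [Pi.add_apply, Pi.smul_apply, Pi.sub_apply, Pi.single_eq_same,
          Pi.single_eq_of_ne hli, smul_eq_mul]
        constructor <;> linarith
      · simp only [Pi.add_apply, Pi.smul_apply, Pi.sub_apply, Pi.single_eq_of_ne hlj,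
          Pi.single_eq_of_ne hli, smul_eq_mul]
        constructor <;> linarith
  refine ⟨⟨fun l => ⟨?_, (hval l).2⟩, ?_⟩,
    infoMatrix_posDef_of_half_le hMx hM fun l => (hval l).1⟩
  · have := (hw.1 l).1
    linarith [(hval l).1]
  · simp only [Pi.add_apply, Pi.smul_apply, Pi.sub_apply, smul_eq_mul, Finset.sum_add_distrib,
      ← Finset.mul_sum, Finset.sum_sub_distrib, Finset.sum_pi_single', hw.2]
    simp

/-- The resolvent identity extracts an exact factor `t`. -/
theorem Sigma_sub_Sigma {N k q : ℕ} (G : Matrix (Fin q) (Fin k) ℝ)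
    (Mx : Fin N → Matrix (Fin k) (Fin k) ℝ) {w d : Fin N → ℝ} {t : ℝ}
    (hM : (infoMatrix Mx w).PosDef) (hM' : (infoMatrix Mx (w + t • d)).PosDef) :
    Sigma G Mx (w + t • d) - Sigma G Mx w = -t • (G * (infoMatrix Mx w)⁻¹ * infoMatrix Mx d *
      (infoMatrix Mx (w + t • d))⁻¹ * Gᵀ) := by
  have hd : infoMatrix Mx w - infoMatrix Mx (w + t • d) = -t • infoMatrix Mx d := by
    rw [infoMatrix_add, infoMatrix_smul, neg_smul]; abel
  have h1 := nonsing_inv_mul _ ((isUnit_iff_isUnit_det _).1 hM.isUnit)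
  have h2 := mul_nonsing_inv _ ((isUnit_iff_isUnit_det _).1 hM'.isUnit)
  have hinv : (infoMatrix Mx (w + t • d))⁻¹ - (infoMatrix Mx w)⁻¹ =
      (infoMatrix Mx w)⁻¹ * (infoMatrix Mx w - infoMatrix Mx (w + t • d)) *
        (infoMatrix Mx (w + t • d))⁻¹ := by
    rw [mul_sub, sub_mul, h1, one_mul, mul_assoc, h2, mul_one]
  have : Sigma G Mx (w + t • d) - Sigma G Mx w =
      G * ((infoMatrix Mx (w + t • d))⁻¹ - (infoMatrix Mx w)⁻¹) * Gᵀ := by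
    rw [Sigma, Sigma, Matrix.mul_sub, Matrix.sub_mul]
  rw [this, hinv, hd]
  simp only [Matrix.mul_smul, Matrix.smul_mul, Matrix.mul_assoc]

theorem tendsto_inv_infoMatrix {N k : ℕ} (Mx : Fin N → Matrix (Fin k) (Fin k) ℝ)
    {w : Fin N → ℝ} (hM : (infoMatrix Mx w).PosDef) (d : Fin N → ℝ) :
    Tendsto (fun t : ℝ => (infoMatrix Mx (w + t • d))⁻¹) (𝓝[>] 0) (𝓝 (infoMatrix Mx w)⁻¹) := by
  have hc : Continuous fun t : ℝ => infoMatrix Mx (w + t • d) := by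
    simp only [infoMatrix_add, infoMatrix_smul]
    fun_prop
  have h0 : infoMatrix Mx (w + (0 : ℝ) • d) = infoMatrix Mx w := by simp
  have hinv : ContinuousAt Inv.inv (infoMatrix Mx (w + (0 : ℝ) • d)) := by
    refine continuousAt_matrix_inv _ ?_
    rw [h0, Ring.inverse_eq_inv']
    exact continuousAt_inv₀ hM.det_pos.ne'
  have := ContinuousAt.comp (f := fun t : ℝ => infoMatrix Mx (w + t • d)) hinv hc.continuousAt
  have h := this.tendsto
  simp only [Function.comp, h0] at h
  exact h.mono_left nhdsWithin_le_nhds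

/-! ### Exchange inequality and threshold. -/

theorem exchange_trace_nonpos {N k q : ℕ} (hq : 1 ≤ q) {p : ℝ} (hp : 0 ≤ p) {ε : ℝ}
    {G : Matrix (Fin q) (Fin k) ℝ} {Mx : Fin N → Matrix (Fin k) (Fin k) ℝ}
    (hMx : ∀ i, (Mx i).PosSemidef) {w : Fin N → ℝ} (hw : IsSolution p ε G Mx w)
    (hdet : p = 0 → (Sigma G Mx w).det ≠ 0) {i j : Fin N} (hij : i ≠ j) (hi : 0 < w i)
    (hj : w j < ε) :
    (matPow (Sigma G Mx w) (p - 1) * (G * (infoMatrix Mx w)⁻¹ * (Mx j - Mx i) *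
      (infoMatrix Mx w)⁻¹ * Gᵀ)).trace ≤ 0 := by
  obtain ⟨hwΩ, hM, hmin⟩ := hw
  set d : Fin N → ℝ := Pi.single j 1 - Pi.single i 1 with hd
  have hinv := tendsto_inv_infoMatrix Mx hM d
  have hA := Sigma_posSemidef G Mx hM
  -- The slack `1` makes the trace bound hold for all small `t`, by continuity.
  obtain ⟨C, hC⟩ := exists_variation_nonneg hq hp hA hdet ((Sigma G Mx w).trace + 1)
  have hS : Tendsto (fun t : ℝ => (Sigma G Mx (w + t • d)).trace) (𝓝[>] 0)
      (𝓝 (Sigma G Mx w).trace) := by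
    have hc : Continuous fun Y : Matrix (Fin k) (Fin k) ℝ => (G * Y * Gᵀ).trace := by fun_prop
    exact (hc.tendsto _).comp hinv
  set X : ℝ → Matrix (Fin q) (Fin q) ℝ := fun t => G * (infoMatrix Mx w)⁻¹ * (Mx j - Mx i) *
      (infoMatrix Mx (w + t • d))⁻¹ * Gᵀ with hX
  set X₀ : Matrix (Fin q) (Fin q) ℝ := G * (infoMatrix Mx w)⁻¹ * (Mx j - Mx i) *
      (infoMatrix Mx w)⁻¹ * Gᵀ with hX₀
  have hXlim : Tendsto X (𝓝[>] 0) (𝓝 X₀) := by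
    have hc : Continuous fun Y : Matrix (Fin k) (Fin k) ℝ =>
      G * (infoMatrix Mx w)⁻¹ * (Mx j - Mx i) * Y * Gᵀ := by fun_prop
    exact (hc.tendsto _).comp hinv
  have hlim : Tendsto (fun t => (matPow (Sigma G Mx w) (p - 1) * X t).trace -
      C * (t * (X t * X t).trace)) (𝓝[>] 0)
      (𝓝 ((matPow (Sigma G Mx w) (p - 1) * X₀).trace - C * (0 * (X₀ * X₀).trace))) := by
    have hc1 : Continuous fun Y : Matrix (Fin q) (Fin q) ℝ =>
      (matPow (Sigma G Mx w) (p - 1) * Y).trace := by fun_prop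
    have hc2 : Continuous fun Y : Matrix (Fin q) (Fin q) ℝ => (Y * Y).trace := by fun_prop
    have ht : Tendsto (fun t : ℝ => t) (𝓝[>] 0) (𝓝 0) := nhdsWithin_le_nhds
    exact ((hc1.tendsto _).comp hXlim).sub ((ht.mul ((hc2.tendsto _).comp hXlim)).const_mul C)
  rw [zero_mul, mul_zero, sub_zero] at hlim
  refine le_of_tendsto hlim ?_
  filter_upwards [eventually_exchange_mem hMx hwΩ hM hij hi hj,
    hS.eventually (eventually_le_nhds (lt_add_one _)), self_mem_nhdsWithin] with t ht htr ht0
  have ht0 : 0 < t := ht0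
  have key := hC _ (Sigma_posSemidef G Mx ht.2)
    (fun v => Sigma_mulVec_eq_zero G Mx hM _) htr (hmin _ ht.1 ht.2)
  have hsub : Sigma G Mx (w + t • d) - Sigma G Mx w = -t • X t := by
    rw [Sigma_sub_Sigma G Mx hM ht.2, infoMatrix_single_sub_single]
  rw [hsub, smul_mul_smul_comm, mul_smul_comm, trace_smul, trace_smul, smul_eq_mul,
    smul_eq_mul] at key
  have : t * ((matPow (Sigma G Mx w) (p - 1) * X t).trace - C * (t * (X t * X t).trace)) ≤ 0 := by
    linarith
  exact nonpos_of_mul_nonpos_right this ht0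

theorem leverage_le_of_exchange {N k q : ℕ} (hq : 1 ≤ q) {p : ℝ} (hp : 0 ≤ p) {ε : ℝ}
    {G : Matrix (Fin q) (Fin k) ℝ} {Mx : Fin N → Matrix (Fin k) (Fin k) ℝ}
    (hMx : ∀ i, (Mx i).PosSemidef) {w : Fin N → ℝ} (hw : IsSolution p ε G Mx w) {i j : Fin N}
    (hi : 0 < w i) (hj : w j < ε) : leverage p G Mx j w ≤ leverage p G Mx i w := by
  rcases eq_or_ne i j with rfl | hij
  · exact le_rfl
  have hA := Sigma_posSemidef G Mx hw.2.1
  by_cases hdet : p = 0 → (Sigma G Mx w).det ≠ 0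
  · have key := exchange_trace_nonpos hq hp hMx hw hdet hij hi hj
    have hq' : (0 : ℝ) ≤ q := Nat.cast_nonneg q
    have htr := trace_matPow_nonneg hA p
    have hdt := hA.det_nonneg
    unfold leverage
    -- The scalar factor is nonnegative and does not depend on the design point.
    refine mul_le_mul_of_nonneg_left ?_ (by split_ifs <;> positivity)
    rw [← sub_nonpos, ← trace_sub]
    refine le_of_eq_of_le ?_ key
    simp only [Matrix.mul_sub, Matrix.sub_mul, Matrix.mul_assoc]
  -- For `p = 0` and singular `Σ_g` the scalar factor vanishes, so all leverages are `0`.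
  · push Not at hdet
    have hq' : (1 / (q : ℝ)) ≠ 0 := by
      have : (0 : ℝ) < q := by exact_mod_cast hq
      positivity
    simp [leverage, hdet.1, hdet.2, Real.zero_rpow hq', -one_div]

theorem exists_threshold {N : ℕ} {ε : ℝ} {w φ : Fin N → ℝ} (hw : ∀ i, 0 ≤ w i ∧ w i ≤ ε)
    (h : ∀ i j, 0 < w i → w j < ε → φ j ≤ φ i) :
    ∃ c : ℝ, ∀ i, (φ i < c → w i = 0) ∧ (c < φ i → w i = ε) := by
  by_cases hne : (Finset.univ.filter fun j => w j < ε).Nonempty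
  · obtain ⟨j, hj, hmax⟩ := Finset.exists_max_image _ φ hne
    have hj : w j < ε := by simpa using hj
    refine ⟨φ j, fun i => ⟨fun hi => ?_, fun hi => ?_⟩⟩
    · by_contra hwi
      exact absurd (h i j (lt_of_le_of_ne (hw i).1 (Ne.symm hwi)) hj) (not_le.2 hi)
    · by_contra hwi
      exact absurd (hmax i (by simpa using lt_of_le_of_ne (hw i).2 hwi)) (not_le.2 hi)
  -- If every weight equals `ε`, any lower bound of `φ` serves.
  · obtain ⟨c, hc⟩ := (Set.finite_range φ).bddBelow
    refine ⟨c, fun i => ⟨fun hi => absurd (hc ⟨i, rfl⟩) (not_le.2 hi), fun _ => ?_⟩⟩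
    by_contra hwi
    exact hne ⟨i, by simpa using lt_of_le_of_ne (hw i).2 hwi⟩

end PhiOpt

end

theorem mainTheorem4 (N k q : ℕ) (hq : 1 ≤ q) (hqk : q ≤ k)
    (Mx : Fin N → Matrix (Fin k) (Fin k) ℝ) (hMx : ∀ i, (Mx i).PosSemidef)
    (g : EuclideanSpace ℝ (Fin k) → EuclideanSpace ℝ (Fin q)) (θ : EuclideanSpace ℝ (Fin k))
    (hg : DifferentiableAt ℝ g θ)
    (p : ℝ) (hp : 0 ≤ p) (ε : ℝ) (hε0 : 0 < ε) (hε1 : ε < 1)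
    (w : Fin N → ℝ) (hw : PhiOpt.IsSolution p ε (PhiOpt.jacobian g θ) Mx w) :
    ∃ c : ℝ, ∀ i : Fin N,
      (PhiOpt.leverage p (PhiOpt.jacobian g θ) Mx i w < c → w i = 0) ∧
      (c < PhiOpt.leverage p (PhiOpt.jacobian g θ) Mx i w → w i = ε) ∧
      (PhiOpt.leverage p (PhiOpt.jacobian g θ) Mx i w = c → 0 ≤ w i ∧ w i ≤ ε) := by
  obtain ⟨c, hc⟩ := PhiOpt.exists_threshold hw.1.1 fun i j hi hj =>
    PhiOpt.leverage_le_of_exchange hq hp hMx hw hi hj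
  exact ⟨c, fun i => ⟨(hc i).1, (hc i).2, fun _ => hw.1.1 i⟩⟩
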